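/- For $n\ge 0$ and $1\le i<n$ let $\xi_i$ be the operator on $\mathbb{Q}[x_1,\dots,x_n]$ given by $\xi_i(f)=\frac{x_i f-x_{i+1}\,s_i(f)}{x_i-x_{i+1}}$, where $s_i$ interchanges $x_i$ and $x_{i+1}$. The key polynomials $\mathcal{K}_\alpha\in\mathbb{Q}[x_1,\dots,x_n]$, $\alpha\in\mathbb{Z}_{\ge 0}^n$, are the unique family such that $\mathcal{K}_\alpha=x^\alpha$ if $\alpha_1\ge\dots\ge\alpha_n$, and $\mathcal{K}_{s_i(\alpha)}=\xi_i(\mathcal{K}_\alpha)$ whenever $\alpha_i>\alpha_{i+1}$. Let $\mathrm{Par}$ be the set of all partitions, let $r\ge 0$, and let $X_i=\{x_{i,1},x_{i,2},\dots\}$ for $1\le i\le r$ be infinite sets of variables. For $\lambda=(\lambda^{(1)}|\cdots|\lambda^{(r)})\in\mathrm{Par}^r$ and $n_i\ge\ell(\lambda^{(i)})$ put $$\mathcal{S}_{\lambda}^{(n_1|\cdots|n_r)}=\mathcal{K}_{(0^{n_1-\ell(\lambda^{(1)})}*\mathrm{rev}(\lambda^{(1)}))*\cdots*(0^{n_r-\ell(\lambda^{(r)})}*\mathrm{rev}(\lambda^{(r)}))}(x_{1,1},\dots,x_{1,n_1},\dots,x_{r,1},\dots,x_{r,n_r}),$$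 where $*$ is concatenation and $\mathrm{rev}$ reverses a sequence, and let $\mathcal{S}_\lambda=\lim_{n_1,\dots,n_r\to\infty}\mathcal{S}_\lambda^{(n_1|\cdots|n_r)}$, a limit of formal power series (every coefficient is eventually constant). Let $m_\mu=m_{\mu^{(1)}}(X_1)\cdots m_{\mu^{(r)}}(X_r)$ for $\mu=(\mu^{(1)}|\cdots|\mu^{(r)})\in\mathrm{Par}^r$, where $m_{\mu^{(i)}}(X_i)$ is the monomial symmetric function, and let the multi-symmetric Kostka coefficients $K^\lambda_\mu$ be defined by the finite expansion $\mathcal{S}_\lambda=\sum_{\mu\in\mathrm{Par}^r}K^\lambda_\mu m_\mu$. For $\mu,\lambda\in\mathrm{Par}$ write $\mu<_L\lambda$ if there is $k\ge 1$ with $\mu_i=\lambda_i$ for all $i<k$ and $\mu_k<\lambda_k$ (partitions being extended by zeros). For $\mu,\lambda\in\mathrm{Par}^r$ write $\mu\prec\lambda$ if there is $1\le k\le r$ with $\mu^{(i)}=\lambda^{(i)}$ for all $i>k$ and $\mu^{(k)}<_L\lambda^{(k)}$. Theorem. For every $\lambda\in\mathrm{Par}^r$ the limit $\mathcal{S}_\lambda$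 exists, the coefficients $K^\lambda_\mu$ exist and are uniquely determined (with only finitely many nonzero), and $$\mathcal{S}_{\lambda}=m_{\lambda}+\sum_{\mu\prec\lambda}K^\lambda_\mu\, m_\mu .$$ -/

import Mathlib

namespace MultiSchur

open MvPolynomial Filter

noncomputable section

section KeyPolynomials

variable {n : ℕ}

/-- `x f(x,y) - y f(y,x)` is divisible by `x - y` (with `x`, `y` two of the variables). -/
theorem sub_dvd_xi (i j : Fin n) (f : MvPolynomial (Fin n) ℚ) :
    (X i - X j : MvPolynomial (Fin n) ℚ) ∣ X i * f - X j * rename (Equiv.swap i j) f := by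
  have key : (X i - X j : MvPolynomial (Fin n) ℚ) ∣ f - rename (Equiv.swap i j) f := by
    rw [← Ideal.mem_span_singleton, ← Ideal.Quotient.eq]
    set I := Ideal.span {(X i - X j : MvPolynomial (Fin n) ℚ)} with hI
    have hij : Ideal.Quotient.mk I (X i) = Ideal.Quotient.mk I (X j) := by
      rw [Ideal.Quotient.eq, hI]
      exact Ideal.mem_span_singleton_self _
    have h : (Ideal.Quotient.mkₐ ℚ I) =
        (Ideal.Quotient.mkₐ ℚ I).comp (rename (Equiv.swap i j)) := by
      apply MvPolynomial.algHom_ext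
      intro k
      simp only [Ideal.Quotient.mkₐ_eq_mk, AlgHom.comp_apply, rename_X]
      by_cases h1 : k = i
      · subst h1; simp [hij]
      · by_cases h2 : k = j
        · subst h2; simp [hij]
        · rw [Equiv.swap_apply_of_ne_of_ne h1 h2]
    exact DFunLike.congr_fun h f
  have : X i * f - X j * rename (Equiv.swap i j) f =
      (X i - X j) * f + X j * (f - rename (Equiv.swap i j) f) := by ring
  rw [this]
  exact dvd_add (dvd_mul_right _ _) (key.mul_left _)

/-- The isobaric divided difference operator
`ξ_{x,y} f = (x f(x,y) - y f(y,x)) / (x - y)`, with `x = x_i` and `y = x_j`. -/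
def xi (i j : Fin n) (f : MvPolynomial (Fin n) ℚ) : MvPolynomial (Fin n) ℚ :=
  (sub_dvd_xi i j f).choose

theorem xi_spec (i j : Fin n) (f : MvPolynomial (Fin n) ℚ) :
    (X i - X j) * xi i j f = X i * f - X j * rename (Equiv.swap i j) f :=
  (sub_dvd_xi i j f).choose_spec.symm

/-- The two defining properties of the family of key polynomials in `n` variables. -/
structure IsKeyFamily (K : (Fin n → ℕ) → MvPolynomial (Fin n) ℚ) : Prop where
  dominant : ∀ α : Fin n → ℕ, Antitone α → K α = ∏ p, X p ^ α p
  step : ∀ (α : Fin n → ℕ) (i j : Fin n), (i : ℕ) + 1 = j → α j < α i →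
    K (α ∘ Equiv.swap i j) = xi i j (K α)

theorem X_sub_X_ne_zero {i j : Fin n} (h : i ≠ j) :
    (X i - X j : MvPolynomial (Fin n) ℚ) ≠ 0 :=
  sub_ne_zero.mpr fun e => h (X_injective e)

theorem rename_xi (e : Equiv.Perm (Fin n)) (i j : Fin n) (f : MvPolynomial (Fin n) ℚ) :
    (X (e i) - X (e j)) * rename e (xi i j f) =
      X (e i) * rename e f - X (e j) * rename (e * Equiv.swap i j) f := by
  have := congrArg (rename e) (xi_spec i j f)
  simpa [rename_rename, Equiv.Perm.coe_mul] using this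

theorem swap_comm_of_ne {i j k l : Fin n} (hik : i ≠ k) (hil : i ≠ l) (hjk : j ≠ k)
    (hjl : j ≠ l) : Equiv.swap k l * Equiv.swap i j = Equiv.swap i j * Equiv.swap k l := by
  ext p
  simp only [Equiv.Perm.coe_mul, Function.comp_apply, Equiv.swap_apply_def]
  split_ifs <;> simp_all

theorem swap_braid {i j k : Fin n} (hij : i ≠ j) (hjk : j ≠ k) (hik : i ≠ k) :
    Equiv.swap j k * (Equiv.swap i j * Equiv.swap j k) =
      Equiv.swap i j * (Equiv.swap j k * Equiv.swap i j) := by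
  ext p
  simp only [Equiv.Perm.coe_mul, Function.comp_apply, Equiv.swap_apply_def]
  split_ifs <;> simp_all

theorem xi_comm {i j k l : Fin n} (hij : i ≠ j) (hkl : k ≠ l) (hik : i ≠ k) (hil : i ≠ l)
    (hjk : j ≠ k) (hjl : j ≠ l) (f : MvPolynomial (Fin n) ℚ) :
    xi i j (xi k l f) = xi k l (xi i j f) := by
  have e1 := xi_spec i j (xi k l f)
  have e2 := xi_spec k l f
  have e3 := rename_xi (Equiv.swap i j) k l f
  have e4 := xi_spec k l (xi i j f)
  have e5 := xi_spec i j f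
  have e6 := rename_xi (Equiv.swap k l) i j f
  have c : Equiv.swap k l * Equiv.swap i j = Equiv.swap i j * Equiv.swap k l :=
    swap_comm_of_ne hik hil hjk hjl
  rw [Equiv.swap_apply_of_ne_of_ne hik.symm hjk.symm,
    Equiv.swap_apply_of_ne_of_ne hil.symm hjl.symm] at e3
  rw [Equiv.swap_apply_of_ne_of_ne hik hil, Equiv.swap_apply_of_ne_of_ne hjk hjl, c] at e6
  apply mul_left_cancel₀ (mul_ne_zero (X_sub_X_ne_zero hij) (X_sub_X_ne_zero hkl))
  linear_combination (X k - X l) * e1 + X i * e2 - X j * e3 - (X i - X j) * e4 - X k * e5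
    + X l * e6

theorem rename_swap_xi {i j : Fin n} (hij : i ≠ j) (f : MvPolynomial (Fin n) ℚ) :
    rename (Equiv.swap i j) (xi i j f) = xi i j f := by
  have h := rename_xi (Equiv.swap i j) i j f
  rw [Equiv.swap_apply_left, Equiv.swap_apply_right, Equiv.swap_mul_self] at h
  simp only [Equiv.Perm.coe_one, rename_id, AlgHom.id_apply] at h
  apply mul_left_cancel₀ (X_sub_X_ne_zero hij)
  linear_combination -h - xi_spec i j f

theorem xi_braid {i j k : Fin n} (hij : i ≠ j) (hjk : j ≠ k) (hik : i ≠ k)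
    (f : MvPolynomial (Fin n) ℚ) :
    xi i j (xi j k (xi i j f)) = xi j k (xi i j (xi j k f)) := by
  have sk : Equiv.swap i j k = k := Equiv.swap_apply_of_ne_of_ne hik.symm hjk.symm
  have ti : Equiv.swap j k i = i := Equiv.swap_apply_of_ne_of_ne hij hik
  have br : Equiv.swap j k * (Equiv.swap i j * Equiv.swap j k) =
      Equiv.swap i j * (Equiv.swap j k * Equiv.swap i j) :=
    swap_braid hij hjk hik
  have a1 := xi_spec i j (xi j k (xi i j f))
  have a2 := xi_spec j k (xi i j f)
  have a3 := rename_xi (Equiv.swap i j) j k (xi i j f)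
  have a4 := xi_spec i j f
  have a5 := rename_xi (Equiv.swap j k) i j f
  have a6 := rename_swap_xi hij f
  have a7 := rename_xi (Equiv.swap i j * Equiv.swap j k) i j f
  have b1 := xi_spec j k (xi i j (xi j k f))
  have b2 := xi_spec i j (xi j k f)
  have b3 := rename_xi (Equiv.swap j k) i j (xi j k f)
  have b4 := xi_spec j k f
  have b5 := rename_xi (Equiv.swap i j) j k f
  have b6 := rename_swap_xi hjk f
  have b7 := rename_xi (Equiv.swap j k * Equiv.swap i j) j k f
  simp only [Equiv.Perm.mul_apply, Equiv.swap_apply_left, Equiv.swap_apply_right, sk, ti,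
    mul_assoc, br] at a3 a5 a7 b3 b5 b7
  apply mul_left_cancel₀ (mul_ne_zero (mul_ne_zero (X_sub_X_ne_zero hij) (X_sub_X_ne_zero hjk))
    (X_sub_X_ne_zero hik))
  linear_combination (X j - X k) * (X i - X k) * a1 + X i * (X i - X k) * a2
    - X j * (X j - X k) * a3 + X i * X j * a4 - X i * X k * a5
    - X j * X i * (X j - X k) * a6 + X j * X k * a7
    - (X i - X j) * (X i - X k) * b1 - X j * (X i - X k) * b2 + X k * (X i - X j) * b3
    - X i ^ 2 * b4 + X j ^ 2 * b5 + X k * X i * (X i - X j) * b6 - X k ^ 2 * b7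

/-- An auxiliary weight that drops when an ascent is removed. -/
def wt (α : Fin n → ℕ) : ℕ := ∑ p : Fin n, (p : ℕ) * α p

theorem wt_swap_lt (α : Fin n → ℕ) {i j : Fin n} (hij : (i : ℕ) + 1 = j) (h : α i < α j) :
    wt (α ∘ Equiv.swap i j) < wt α := by
  have hne : i ≠ j := by rintro rfl; omega
  have hj : j ∈ Finset.univ.erase i := by simp [hne.symm]
  unfold wt
  rw [← Finset.add_sum_erase _ _ (Finset.mem_univ i), ← Finset.add_sum_erase _ _ hj,
    ← Finset.add_sum_erase (a := i) _ (fun p : Fin n => (p : ℕ) * α p) (Finset.mem_univ i),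
    ← Finset.add_sum_erase _ (fun p : Fin n => (p : ℕ) * α p) hj]
  have : ∑ x ∈ (Finset.univ.erase i).erase j, (x : ℕ) * (α ∘ Equiv.swap i j) x =
      ∑ x ∈ (Finset.univ.erase i).erase j, (x : ℕ) * α x := by
    refine Finset.sum_congr rfl fun x hx => ?_
    simp only [Finset.mem_erase, Finset.mem_univ, and_true] at hx
    rw [Function.comp_apply, Equiv.swap_apply_of_ne_of_ne hx.2 hx.1]
  rw [this]
  simp only [Function.comp_apply, Equiv.swap_apply_left, Equiv.swap_apply_right, ← hij]
  nlinarith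

open Classical in
/-- Auxiliary recursive construction of the key polynomials: remove ascents one at a time. -/
def keyAux (α : Fin n → ℕ) : MvPolynomial (Fin n) ℚ :=
  if h : ∃ p : Fin n × Fin n, (p.1 : ℕ) + 1 = p.2 ∧ α p.1 < α p.2 then
    xi h.choose.1 h.choose.2 (keyAux (α ∘ Equiv.swap h.choose.1 h.choose.2))
  else ∏ p, X p ^ α p
termination_by wt α
decreasing_by exact wt_swap_lt α h.choose_spec.1 h.choose_spec.2

theorem keyAux_ascent (N : ℕ) : ∀ (α : Fin n → ℕ), wt α < N → ∀ (i j : Fin n),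
    (i : ℕ) + 1 = j → α i < α j → keyAux α = xi i j (keyAux (α ∘ Equiv.swap i j)) := by
  induction N with
  | zero => intro α h; omega
  | succ N ih =>
    intro α hα
    have diamond : ∀ i j k : Fin n, (i : ℕ) + 1 = j → (j : ℕ) + 1 = k → α i < α j → α j < α k →
        xi i j (keyAux (α ∘ Equiv.swap i j)) = xi j k (keyAux (α ∘ Equiv.swap j k)) := by
      intro i j k hij hjk h1 h2
      have nij : i ≠ j := by rintro rfl; omega
      have njk : j ≠ k := by rintro rfl; omega
      have nik : i ≠ k := by rintro rfl; omega
      have sk : Equiv.swap i j k = k := Equiv.swap_apply_of_ne_of_ne nik.symm njk.symm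
      have ti : Equiv.swap j k i = i := Equiv.swap_apply_of_ne_of_ne nij nik
      have w1 := wt_swap_lt α hij h1
      have w2 := wt_swap_lt α hjk h2
      have l1 : (α ∘ Equiv.swap i j) j < (α ∘ Equiv.swap i j) k := by simp [sk]; omega
      have l2 : (α ∘ Equiv.swap j k) i < (α ∘ Equiv.swap j k) j := by simp [ti]; omega
      have w3 := wt_swap_lt _ hjk l1
      have w4 := wt_swap_lt _ hij l2
      have l3 : ((α ∘ Equiv.swap i j) ∘ Equiv.swap j k) i <
          ((α ∘ Equiv.swap i j) ∘ Equiv.swap j k) j := by simp [sk, ti]; omega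
      have l4 : ((α ∘ Equiv.swap j k) ∘ Equiv.swap i j) j <
          ((α ∘ Equiv.swap j k) ∘ Equiv.swap i j) k := by simp [sk, ti]; omega
      rw [ih _ (by omega) j k hjk l1, ih _ (by omega) i j hij l3,
        ih _ (by omega) i j hij l2, ih _ (by omega) j k hjk l4, xi_braid nij njk nik]
      congr 4
      funext p
      exact congrArg α (Equiv.congr_fun (swap_braid nij njk nik).symm p)
    intro i j hij h
    have hex : ∃ p : Fin n × Fin n, (p.1 : ℕ) + 1 = p.2 ∧ α p.1 < α p.2 := ⟨(i, j), hij, h⟩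
    rw [keyAux, dif_pos hex]
    obtain ⟨hkl, h'⟩ := hex.choose_spec
    generalize hex.choose = q at hkl h' ⊢
    obtain ⟨k, l⟩ := q
    simp only at hkl h' ⊢
    by_cases c1 : k = i
    · obtain rfl : l = j := by ext; subst c1; omega
      rw [c1]
    by_cases c2 : l = i
    · subst c2
      exact diamond k l j hkl hij h' h
    by_cases c3 : j = k
    · subst c3
      exact (diamond i j l hij hkl h h').symm
    have nij : i ≠ j := by rintro rfl; omega
    have nkl : k ≠ l := by rintro rfl; omega
    have njl : j ≠ l := by rintro rfl; exact c1 (by ext; omega)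
    have l1 : (α ∘ Equiv.swap k l) i < (α ∘ Equiv.swap k l) j := by
      simp only [Function.comp_apply]
      rwa [Equiv.swap_apply_of_ne_of_ne (Ne.symm c1) (Ne.symm c2),
        Equiv.swap_apply_of_ne_of_ne c3 njl]
    have l2 : (α ∘ Equiv.swap i j) k < (α ∘ Equiv.swap i j) l := by
      simp only [Function.comp_apply]
      rwa [Equiv.swap_apply_of_ne_of_ne c1 (Ne.symm c3),
        Equiv.swap_apply_of_ne_of_ne c2 njl.symm]
    have w1 := wt_swap_lt α hkl h'
    have w2 := wt_swap_lt α hij h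
    rw [ih _ (by omega) i j hij l1, ih _ (by omega) k l hkl l2,
      xi_comm nkl nij c1 (Ne.symm c3) c2 njl.symm]
    congr 3
    funext p
    exact congrArg α (Equiv.congr_fun
      (swap_comm_of_ne (Ne.symm c1) (Ne.symm c2) c3 njl) p)

theorem antitone_of_no_ascent (α : Fin n → ℕ)
    (h : ¬ ∃ p : Fin n × Fin n, (p.1 : ℕ) + 1 = p.2 ∧ α p.1 < α p.2) : Antitone α := by
  cases n with
  | zero => intro a; exact a.elim0
  | succ m =>
    rw [Fin.antitone_iff_succ_le]
    intro i
    by_contra hc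
    exact h ⟨(i.castSucc, i.succ), by simp, not_le.mp hc⟩

/-- There is exactly one family of key polynomials in `n` variables. -/
theorem existsUnique_isKeyFamily (n : ℕ) :
    ∃! K : (Fin n → ℕ) → MvPolynomial (Fin n) ℚ, IsKeyFamily K := by
  refine ⟨keyAux, ⟨fun α hα => ?_, fun α i j hij h => ?_⟩, fun K hK => ?_⟩
  · rw [keyAux, dif_neg]
    rintro ⟨⟨p, q⟩, hpq, hlt⟩
    exact absurd (hα (show p ≤ q from Fin.le_def.mpr (by simp only at hpq; omega)))
      (not_le.mpr hlt)
  · have := keyAux_ascent _ (α ∘ Equiv.swap i j) (Nat.lt_succ_self _) i j hij (by simpa using h)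
    rw [this, Function.comp_assoc]
    congr 2
    funext p
    simp
  · suffices H : ∀ N, ∀ α : Fin n → ℕ, wt α < N → K α = keyAux α from
      funext fun α => H _ α (Nat.lt_succ_self _)
    intro N
    induction N with
    | zero => intro α h; omega
    | succ N ih =>
      intro α hα
      rw [keyAux]
      split_ifs with hex
      · obtain ⟨hij, h⟩ := hex.choose_spec
        have w := wt_swap_lt α hij h
        rw [← ih _ (by omega), ← hK.step _ _ _ hij (by simpa using h), Function.comp_assoc]
        congr 1
        funext p
        simp
      · exact hK.dominant α (antitone_of_no_ascent α hex)

/-- The key polynomial `𝒦_α(x_1, …, x_n)`. -/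
def keyPoly (α : Fin n → ℕ) : MvPolynomial (Fin n) ℚ :=
  (existsUnique_isKeyFamily n).choose α

theorem isKeyFamily_keyPoly : IsKeyFamily (keyPoly (n := n)) :=
  (existsUnique_isKeyFamily n).choose_spec.1

end KeyPolynomials

/-- A partition: a weakly decreasing, finitely supported sequence `λ_1 ≥ λ_2 ≥ …` of natural
numbers, i.e. the parts followed by infinitely many zeros (`parts 0` is the largest part). -/
@[ext]
structure Par where
  parts : ℕ →₀ ℕ
  anti : Antitone parts

/-- The lexicographic order on partitions: the first differing part decides. -/
def Par.LexLT (μ lam : Par) : Prop :=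
  ∃ k, (∀ i < k, μ.parts i = lam.parts i) ∧ μ.parts k < lam.parts k

/-- The order `≺` on `r`-tuples of partitions: the last differing component decides,
by the lexicographic order on partitions. -/
def Prec {r : ℕ} (μ lam : Fin r → Par) : Prop :=
  ∃ k, (∀ i, k < i → μ i = lam i) ∧ (μ k).LexLT (lam k)

/-- The composition `(0^{n_1-ℓ(λ^1)} * rev λ^1) * ⋯ * (0^{n_r-ℓ(λ^r)} * rev λ^r)` of length
`n_1 + ⋯ + n_r` (for `n_i ≥ ℓ(λ^i)`): the `j`-th entry from the right of the `i`-th window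
is the `j`-th part of `λ^i`. -/
def windowComp {r : ℕ} (lam : Fin r → Par) (n : Fin r → ℕ) : Fin (∑ i, n i) → ℕ :=
  fun p => (lam (finSigmaFinEquiv.symm p).1).parts (Fin.rev (finSigmaFinEquiv.symm p).2)

/-- The multi-symmetric Schur polynomial `𝒮_λ^{(n_1|…|n_r)}`. Its variables are
`x_{i,1}, …, x_{i,n_i}` for `i = 1, …, r`, in this order; `x_{i,j+1}` is the variable
with index `(i, j)`. -/
def multiSchurPoly {r : ℕ} (lam : Fin r → Par) (n : Fin r → ℕ) :
    MvPolynomial (Fin r × ℕ) ℚ :=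
  rename (fun p => ((finSigmaFinEquiv.symm p).1, ((finSigmaFinEquiv.symm p).2 : ℕ)))
    (keyPoly (windowComp lam n))

/-- `f` is the limit, as a formal power series, of the polynomials `F (n_1, …, n_r)` as
`n_1, …, n_r → ∞`: each coefficient is eventually constant, with the value given by `f`. -/
def IsFormalLimit {r : ℕ} {σ : Type*} (F : (Fin r → ℕ) → MvPolynomial σ ℚ)
    (f : MvPowerSeries σ ℚ) : Prop :=
  ∀ d : σ →₀ ℕ, ∀ᶠ n in atTop, MvPolynomial.coeff d (F n) = MvPowerSeries.coeff d f

open Classical in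
/-- The multi-symmetric Schur function `𝒮_λ(X_1|…|X_r)`, as a formal power series in the
variables `x_{i,j}`: the limit of the multi-symmetric Schur polynomials. -/
def multiSchur {r : ℕ} (lam : Fin r → Par) : MvPowerSeries (Fin r × ℕ) ℚ :=
  if h : ∃ f, IsFormalLimit (multiSchurPoly lam) f then h.choose else 0

open Classical in
/-- The monomial symmetric function `m_λ(X_i)` in the `i`-th set of variables: the sum of all
distinct monomials whose exponent sequence is a rearrangement of `λ`. -/
def monomialSym {r : ℕ} (i : Fin r) (lam : Par) : MvPowerSeries (Fin r × ℕ) ℚ :=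
  fun d => if ∃ w : Equiv.Perm ℕ, d = lam.parts.mapDomain (fun j => (i, w j)) then 1 else 0

/-- The monomial multi-symmetric function `m_λ = m_{λ^1}(X_1) ⋯ m_{λ^r}(X_r)`. -/
def multiMonomial {r : ℕ} (lam : Fin r → Par) : MvPowerSeries (Fin r × ℕ) ℚ :=
  ∏ i, monomialSym i (lam i)

/-- `c` is a (finite) expansion of `f` into monomial multi-symmetric functions,
`f = ∑_μ c_μ m_μ`. -/
def IsMonomialExpansion {r : ℕ} (f : MvPowerSeries (Fin r × ℕ) ℚ)
    (c : (Fin r → Par) →₀ ℚ) : Prop :=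
  f = ∑ μ ∈ c.support, c μ • multiMonomial μ

open Classical in
/-- The multi-symmetric Kostka coefficients `K^λ_μ`: the coefficients in the expansion of
`𝒮_λ` into monomial multi-symmetric functions. -/
def kostka {r : ℕ} (lam : Fin r → Par) : (Fin r → Par) →₀ ℚ :=
  if h : ∃ c, IsMonomialExpansion (multiSchur lam) c then h.choose else 0

end

end MultiSchur

/-! Write `K_α` for `keyPoly α`. Its degree in the last variable is at most the last entry of `α`,
and the coefficient of that extreme power is the key polynomial of `α` without its last entry
(`coeff_keyPoly_eq_zero_of_lt`, `coeff_keyPoly_add_single`). Peeling off variables from the right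
shows that `x^α` has coefficient 1 and that any other exponent of `K_α` is smaller than `α` where
the two last differ (`eq_or_lt_of_coeff_keyPoly_ne_zero`). Partitions are written reversed inside
the windows, so for window compositions this comparison from the right is exactly `≺`.

Three further facts pass from polynomials to `𝒮_λ`. Each window is weakly increasing, which makes
the polynomial symmetric in the variables of each window (`rename_perm_keyPoly`), so a coefficient
depends only on the sorted type `μ` of its exponent. Enlarging windows only inserts zeros, which
leaves these coefficients unchanged (`coeff_keyPoly_mapDomain`), so they have stable values.
Homogeneity leaves only finitely many types. Hence the stable coefficients are the coefficients of
the limit in the basis `m_μ`.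

The statements about `K_α` are proved by removing adjacent ascents, using a recursion for the
coefficients of `xi i j f`. -/

namespace MultiSchur

open MvPolynomial Filter

/-! ### Coefficients of `ξ_i f` -/

section XiCoefficients

variable {n : ℕ}

/-- Compare coefficients at `d + e_i + e_j` in `xi_spec`. This is a recursion that trades one unit
of the `j`-exponent for one of the `i`-exponent, ending at `j`-exponent 0, where
`coeff_xi_of_right_eq_zero` applies. -/
theorem coeff_xi_add_single (i j : Fin n) (f : MvPolynomial (Fin n) ℚ) (d : Fin n →₀ ℕ) :
    coeff (d + Finsupp.single j 1) (xi i j f) = coeff (d + Finsupp.single i 1) (xi i j f) +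
      coeff (d + Finsupp.single j 1) f -
      coeff ((d + Finsupp.single i 1).mapDomain (Equiv.swap i j)) f := by
  have h := congrArg (coeff (d + Finsupp.single i 1 + Finsupp.single j 1)) (xi_spec i j f)
  rw [sub_mul, coeff_sub, coeff_sub, mul_comm (X j), mul_comm (X j), coeff_mul_X, coeff_mul_X,
    add_right_comm, mul_comm (X i), mul_comm (X i), coeff_mul_X, coeff_mul_X] at h
  have h' : coeff (d + Finsupp.single i 1) (rename (Equiv.swap i j) f) =
      coeff ((d + Finsupp.single i 1).mapDomain (Equiv.swap i j)) f := by
    rw [← coeff_rename_mapDomain _ (Equiv.swap i j).injective, rename_rename,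
      ← Equiv.Perm.coe_mul, Equiv.swap_mul_self, Equiv.Perm.coe_one, rename_id_apply]
  rw [← h']
  linear_combination h

theorem coeff_xi_of_right_eq_zero {i j : Fin n} (hij : i ≠ j) (f : MvPolynomial (Fin n) ℚ)
    {d : Fin n →₀ ℕ} (hd : d j = 0) : coeff d (xi i j f) = coeff d f := by
  have h := congrArg (coeff (d + Finsupp.single i 1)) (xi_spec i j f)
  have hj : j ∉ (d + Finsupp.single i 1).support := by simp [hd, hij]
  rw [sub_mul, coeff_sub, coeff_sub, coeff_X_mul' _ j, coeff_X_mul' _ j, if_neg hj, if_neg hj,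
    mul_comm (X i), mul_comm (X i), coeff_mul_X, coeff_mul_X] at h
  simpa using h

theorem coeff_mapDomain_swap_xi {i j : Fin n} (hij : i ≠ j) (f : MvPolynomial (Fin n) ℚ)
    (d : Fin n →₀ ℕ) :
    coeff (d.mapDomain (Equiv.swap i j)) (xi i j f) = coeff d (xi i j f) := by
  conv_lhs => rw [← rename_swap_xi hij]
  exact coeff_rename_mapDomain _ (Equiv.swap i j).injective _ _

theorem coeff_xi_of_left_eq_zero {i j : Fin n} (hij : i ≠ j) (f : MvPolynomial (Fin n) ℚ)
    {d : Fin n →₀ ℕ} (hd : d i = 0) :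
    coeff d (xi i j f) = coeff (d.mapDomain (Equiv.swap i j)) f := by
  rw [← coeff_mapDomain_swap_xi hij, coeff_xi_of_right_eq_zero hij]
  simpa [Finsupp.mapDomain_equiv_apply] using hd

/-- An induction on the exponent of the `j`-th variable, adapted to the recursion for the
coefficients of `xi i j f`. -/
theorem exponent_induction (j : Fin n) {P : (Fin n →₀ ℕ) → Prop}
    (zero : ∀ d, d j = 0 → P d)
    (succ : ∀ d, (∀ d', d' j = d j → P d') → P (d + Finsupp.single j 1)) (d : Fin n →₀ ℕ) :
    P d := by
  induction h : d j generalizing d with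
  | zero => exact zero d h
  | succ b ih =>
    have hd : d = (d - Finsupp.single j 1) + Finsupp.single j 1 := by
      refine (tsub_add_cancel_of_le ?_).symm
      rw [Finsupp.single_le_iff]; omega
    have hb : (d - Finsupp.single j 1 : Fin n →₀ ℕ) j = b := by simp [h]
    rw [hd]
    exact succ _ fun d' h' => ih d' (h'.trans hb)

/-- In the recursion, the two terms other than `coeff (d + e_j) f` involve an exponent above `a`,
hence vanish: the operator does not alter the extreme coefficients in `x_i`. -/
theorem coeff_xi_of_le_left {i j : Fin n} (hij : i ≠ j) {f : MvPolynomial (Fin n) ℚ} {a : ℕ}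
    (hi : ∀ d : Fin n →₀ ℕ, a < d i → coeff d f = 0)
    (hj : ∀ d : Fin n →₀ ℕ, a < d j → coeff d f = 0) {d : Fin n →₀ ℕ} (hd : a ≤ d i) :
    coeff d (xi i j f) = coeff d f := by
  induction d using exponent_induction j with
  | zero d h => exact coeff_xi_of_right_eq_zero hij f h
  | succ d ih =>
    have hd' : a ≤ d i := by simpa [hij] using hd
    rw [coeff_xi_add_single, ih _ (by simp [hij]) (by simp; omega), hi (d + Finsupp.single i 1),
      hj (Finsupp.mapDomain (Equiv.swap i j) (d + Finsupp.single i 1))]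
    · ring
    · rw [Finsupp.mapDomain_equiv_apply]; simp; omega
    · simp; omega

theorem coeff_xi_of_le_right {i j : Fin n} (hij : i ≠ j) {f : MvPolynomial (Fin n) ℚ} {a : ℕ}
    (hi : ∀ d : Fin n →₀ ℕ, a < d i → coeff d f = 0)
    (hj : ∀ d : Fin n →₀ ℕ, a < d j → coeff d f = 0) {d : Fin n →₀ ℕ} (hd : a ≤ d j) :
    coeff d (xi i j f) = coeff (d.mapDomain (Equiv.swap i j)) f := by
  rw [← coeff_mapDomain_swap_xi hij, coeff_xi_of_le_left hij hi hj]
  simpa [Finsupp.mapDomain_equiv_apply] using hd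

/-- A vanishing condition survives `xi i j` if it is stable under the two moves of the recursion. It
is applied to degree bounds in a third variable and to total degree. -/
theorem coeff_xi_eq_zero {i j : Fin n} (hij : i ≠ j) {f : MvPolynomial (Fin n) ℚ}
    {P : (Fin n →₀ ℕ) → Prop}
    (hP : ∀ d, P (d + Finsupp.single j 1) → P (d + Finsupp.single i 1))
    (hs : ∀ d, P d → P (d.mapDomain (Equiv.swap i j)))
    (hf : ∀ d, P d → coeff d f = 0) {d : Fin n →₀ ℕ} (hd : P d) : coeff d (xi i j f) = 0 := by
  induction d using exponent_induction j with
  | zero d h => rw [coeff_xi_of_right_eq_zero hij f h, hf d hd]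
  | succ d ih =>
    rw [coeff_xi_add_single, ih _ (by simp [hij]) (hP _ hd), hf _ hd, hf _ (hs _ (hP _ hd))]
    ring

/-- Extracting the coefficient of a monomial free of `x_i` and `x_j` commutes with `xi`, since both
sides obey the same recursion. It serves with `d₀ = 0` for deleting zeros and with `d₀` a power of
one variable for extreme coefficients. -/
theorem coeff_mapDomain_add_xi {m : ℕ} {e : Fin m → Fin n} (he : Function.Injective e)
    {i j : Fin m} (hij : i ≠ j) {f : MvPolynomial (Fin n) ℚ} {g : MvPolynomial (Fin m) ℚ}
    {d₀ : Fin n →₀ ℕ} (hi : d₀ (e i) = 0) (hj : d₀ (e j) = 0)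
    (hfg : ∀ d, coeff (d.mapDomain e + d₀) f = coeff d g) (d : Fin m →₀ ℕ) :
    coeff (d.mapDomain e + d₀) (xi (e i) (e j) f) = coeff d (xi i j g) := by
  have hs : ∀ d : Fin m →₀ ℕ, (d.mapDomain e + d₀).mapDomain (Equiv.swap (e i) (e j)) =
      (d.mapDomain (Equiv.swap i j)).mapDomain e + d₀ := by
    intro d
    rw [Finsupp.mapDomain_add, ← Finsupp.mapDomain_comp, ← Finsupp.mapDomain_comp,
      he.swap_comp]
    congr 1
    ext p
    rw [Finsupp.mapDomain_equiv_apply, Equiv.symm_swap, Equiv.swap_apply_def]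
    split_ifs with h1 h2
    · rw [h1, hi, hj]
    · rw [h2, hi, hj]
    · rfl
  have ha : ∀ (d : Fin m →₀ ℕ) k, (d + Finsupp.single k 1).mapDomain e + d₀ =
      (d.mapDomain e + d₀) + Finsupp.single (e k) 1 := by
    intro d k
    rw [Finsupp.mapDomain_add, Finsupp.mapDomain_single, add_right_comm]
  induction d using exponent_induction j with
  | zero d h =>
    rw [coeff_xi_of_right_eq_zero hij g h, coeff_xi_of_right_eq_zero (he.ne hij), hfg]
    simp [he, h, hj]
  | succ d ih =>
    rw [ha, coeff_xi_add_single, coeff_xi_add_single, ← ha, ← ha, ih _ (by simp [hij]), hs, hfg,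
      hfg]

theorem xi_eq_self {i j : Fin n} (hij : i ≠ j) {f : MvPolynomial (Fin n) ℚ}
    (h : rename (Equiv.swap i j) f = f) : xi i j f = f := by
  apply mul_left_cancel₀ (X_sub_X_ne_zero hij)
  rw [xi_spec, h, sub_mul]

theorem xi_xi {i j : Fin n} (hij : i ≠ j) (f : MvPolynomial (Fin n) ℚ) :
    xi i j (xi i j f) = xi i j f :=
  xi_eq_self hij (rename_swap_xi hij f)

end XiCoefficients

/-! ### Stability, degree bounds and triangularity of key polynomials -/

section KeyCoefficients

variable {n : ℕ}

theorem keyPoly_of_antitone {α : Fin n → ℕ} (h : Antitone α) :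
    keyPoly α = monomial (Finsupp.equivFunOnFinite.symm α) 1 := by
  rw [isKeyFamily_keyPoly.dominant α h, monomial_eq]
  simp [Finsupp.prod_fintype]

theorem keyPoly_of_ascent {α : Fin n → ℕ} {i j : Fin n} (hij : (i : ℕ) + 1 = j)
    (h : α i < α j) : keyPoly α = xi i j (keyPoly (α ∘ Equiv.swap i j)) := by
  rw [← isKeyFamily_keyPoly.step _ i j hij (by simpa using h), Function.comp_assoc]
  congr 1
  funext p
  simp

theorem ascent_induction {P : (Fin n → ℕ) → Prop} (antitone : ∀ α, Antitone α → P α)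
    (ascent : ∀ α (i j : Fin n), (i : ℕ) + 1 = j → α i < α j →
      (∀ β, wt β < wt α → P β) → P α) (α : Fin n → ℕ) : P α := by
  induction h : wt α using Nat.strong_induction_on generalizing α with
  | _ N ih =>
    by_cases hex : ∃ p : Fin n × Fin n, (p.1 : ℕ) + 1 = p.2 ∧ α p.1 < α p.2
    · obtain ⟨⟨i, j⟩, hij, hlt⟩ := hex
      exact ascent α i j hij hlt fun β hβ => ih _ (h ▸ hβ) β rfl
    · exact antitone α (antitone_of_no_ascent α hex)

theorem ne_of_val_add_one {i j : Fin n} (hij : (i : ℕ) + 1 = j) : i ≠ j := by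
  rintro rfl; omega

/-- An adjacent transposition reverses the order of the pair `i`, `j` only, and `e` misses one of
the two. -/
theorem strictMono_swap_comp {m : ℕ} {e : Fin m → Fin n} (he : StrictMono e) {i j : Fin n}
    (hij : (i : ℕ) + 1 = j) (h : i ∉ Set.range e ∨ j ∉ Set.range e) :
    StrictMono (Equiv.swap i j ∘ e) := by
  intro a b hab
  have hlt := he hab
  have ha : e a ∈ Set.range e := ⟨a, rfl⟩
  have hb : e b ∈ Set.range e := ⟨b, rfl⟩
  simp only [Function.comp_apply, Equiv.swap_apply_def]
  have key : ¬ (e a = i ∧ e b = j) := by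
    rintro ⟨rfl, rfl⟩
    tauto
  simp only [Fin.lt_def, Fin.ext_iff] at *
  split_ifs <;> omega

theorem mapDomain_equivFunOnFinite_comp {m : ℕ} {e : Fin m → Fin n}
    (he : Function.Injective e) {α : Fin n → ℕ} (h : ∀ p, p ∉ Set.range e → α p = 0) :
    (Finsupp.equivFunOnFinite.symm (α ∘ e)).mapDomain e = Finsupp.equivFunOnFinite.symm α := by
  ext p
  by_cases hp : p ∈ Set.range e
  · obtain ⟨a, rfl⟩ := hp
    simp [he]
  · rw [Finsupp.mapDomain_of_notMem_range _ _ hp]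
    simp [h p hp]

theorem mapDomain_equivFunOnFinite_comp_add_single {m : ℕ} {e : Fin m → Fin n}
    (he : Function.Injective e) {q : Fin n} (hq : ∀ p, p ∈ Set.range e ↔ p ≠ q)
    (α : Fin n → ℕ) :
    (Finsupp.equivFunOnFinite.symm (α ∘ e)).mapDomain e + Finsupp.single q (α q) =
      Finsupp.equivFunOnFinite.symm α := by
  ext p
  by_cases hp : p = q
  · subst hp
    rw [Finsupp.add_apply, Finsupp.mapDomain_of_notMem_range _ _ (by simp [hq])]
    simp
  · obtain ⟨a, rfl⟩ := (hq p).mpr hp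
    simp [he, Ne.symm hp]

theorem exists_adjacent_preimage {m : ℕ} {e : Fin m → Fin n} (he : StrictMono e) {i j : Fin n}
    (hij : (i : ℕ) + 1 = j) (hi : i ∈ Set.range e) (hj : j ∈ Set.range e) :
    ∃ a b : Fin m, (a : ℕ) + 1 = b ∧ e a = i ∧ e b = j := by
  obtain ⟨a, rfl⟩ := hi
  obtain ⟨b, rfl⟩ := hj
  have hab : a < b := he.lt_iff_lt.mp (Fin.lt_def.mpr (by omega))
  refine ⟨a, b, ?_, rfl, rfl⟩
  by_contra hne
  have hlt : (a : ℕ) + 1 < b := by have := Fin.lt_def.mp hab; omega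
  have h1 : e a < e ⟨a + 1, by omega⟩ := he (Fin.lt_def.mpr (by simp))
  have h2 : e ⟨a + 1, by omega⟩ < e b := he (Fin.lt_def.mpr hlt)
  rw [Fin.lt_def] at h1 h2
  omega

/-- Key polynomials are stable: variables at which the composition vanishes can be deleted by
setting them to zero. -/
theorem coeff_keyPoly_mapDomain (α : Fin n → ℕ) {m : ℕ} (e : Fin m → Fin n) (he : StrictMono e)
    (h₀ : ∀ p, p ∉ Set.range e → α p = 0) (d : Fin m →₀ ℕ) :
    coeff (d.mapDomain e) (keyPoly α) = coeff d (keyPoly (α ∘ e)) := by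
  induction α using ascent_induction generalizing e d with
  | antitone α hα =>
    rw [keyPoly_of_antitone hα, keyPoly_of_antitone (hα.comp_monotone he.monotone),
      ← mapDomain_equivFunOnFinite_comp he.injective h₀, coeff_monomial, coeff_monomial]
    simp only [(Finsupp.mapDomain_injective he.injective).eq_iff]
  | ascent α i j hij hlt ih =>
    have hne := ne_of_val_add_one hij
    -- Deleted positions carry the entry 0, whereas `α j > α i ≥ 0`; so only `i` can be deleted.
    have hj : j ∈ Set.range e := by
      by_contra hj
      have := h₀ j hj
      omega
    rw [keyPoly_of_ascent hij hlt]
    by_cases hi : i ∈ Set.range e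
    · obtain ⟨a, b, hab, rfl, rfl⟩ := exists_adjacent_preimage he hij hi hj
      have hcomp : (α ∘ Equiv.swap (e a) (e b)) ∘ e = (α ∘ e) ∘ Equiv.swap a b := by
        rw [Function.comp_assoc, he.injective.swap_comp, Function.comp_assoc]
      rw [keyPoly_of_ascent hab (α := α ∘ e) hlt, ← hcomp]
      have := coeff_mapDomain_add_xi he.injective (ne_of_val_add_one hab) (d₀ := 0) rfl rfl
        (f := keyPoly (α ∘ Equiv.swap (e a) (e b)))
        (g := keyPoly ((α ∘ Equiv.swap (e a) (e b)) ∘ e)) ?_ d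
      · simpa using this
      · intro d
        rw [add_zero]
        refine ih _ (wt_swap_lt α hij hlt) e he (fun p hp => ?_) d
        rw [Function.comp_apply, Equiv.swap_apply_of_ne_of_ne]
        · exact h₀ p hp
        · rintro rfl; exact hp ⟨a, rfl⟩
        · rintro rfl; exact hp ⟨b, rfl⟩
    -- Here `x_i` does not occur in the monomial, so `xi` merely swaps exponents: the zero entry now
    -- sits at `j`, and `swap i j ∘ e` is the embedding that omits it.
    · rw [coeff_xi_of_left_eq_zero hne _ (Finsupp.mapDomain_of_notMem_range _ _ hi),
        ← Finsupp.mapDomain_comp, ih _ (wt_swap_lt α hij hlt) _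
          (strictMono_swap_comp he hij (Or.inl hi))]
      · congr 2
        funext p
        simp
      · intro p hp
        have hp' : Equiv.swap i j p ∉ Set.range e := by
          rintro ⟨q, hq⟩
          exact hp ⟨q, by simp [hq]⟩
        exact h₀ _ hp'

/-- The degree of a key polynomial in the `k`-th variable is at most the largest entry of the
composition from the `k`-th on. -/
theorem coeff_keyPoly_eq_zero_of_lt (α : Fin n → ℕ) {k : Fin n} {a : ℕ}
    (hk : ∀ p, k ≤ p → α p ≤ a) {d : Fin n →₀ ℕ} (hd : a < d k) :
    coeff d (keyPoly α) = 0 := by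
  induction α using ascent_induction generalizing k d with
  | antitone α hα =>
    rw [keyPoly_of_antitone hα, coeff_monomial, if_neg]
    rintro rfl
    exact absurd (hk k le_rfl) (by simpa using hd)
  | ascent α i j hij hlt ih =>
    have hne := ne_of_val_add_one hij
    rw [keyPoly_of_ascent hij hlt]
    have ih' := fun {k d} => ih (α ∘ Equiv.swap i j) (wt_swap_lt α hij hlt) (k := k) (d := d)
    -- If `k` is one of the swapped positions, all entries of the swapped composition from `i` on
    -- are at most `a`, so both degrees are bounded and the extreme-coefficient lemmas apply.
    -- Otherwise `xi i j` cannot raise the degree in `x_k`.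
    by_cases hki : k = i ∨ k = j
    · have hi : ∀ p, i ≤ p → (α ∘ Equiv.swap i j) p ≤ a := by
        intro p hp
        have hj : α j ≤ a := hk j (by
          rcases hki with h | h <;> rw [h, Fin.le_def]; omega)
        rw [Function.comp_apply, Equiv.swap_apply_def]
        split_ifs with h1 h2
        · exact hj
        · omega
        · refine hk p ?_
          rw [Fin.le_def] at hp ⊢
          rw [Fin.ext_iff] at h1 h2
          rcases hki with rfl | rfl <;> omega
      have vi : ∀ d : Fin n →₀ ℕ, a < d i → coeff d (keyPoly (α ∘ Equiv.swap i j)) = 0 :=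
        fun d hd => ih' hi hd
      have vj : ∀ d : Fin n →₀ ℕ, a < d j → coeff d (keyPoly (α ∘ Equiv.swap i j)) = 0 :=
        fun d hd => ih' (fun p hp => hi p (le_trans (Fin.le_def.mpr (by omega)) hp)) hd
      rcases hki with rfl | rfl
      · rw [coeff_xi_of_le_left hne vi vj hd.le, vi d hd]
      · rw [coeff_xi_of_le_right hne vi vj hd.le, vi]
        simpa [Finsupp.mapDomain_equiv_apply] using hd
    · push Not at hki
      refine coeff_xi_eq_zero hne (P := fun d => a < d k) ?_ ?_ (fun d hd => ih' ?_ hd) hd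
      · intro d
        simp [hki.1.symm, hki.2.symm]
      · intro d
        simp [Finsupp.mapDomain_equiv_apply, Equiv.swap_apply_of_ne_of_ne hki.1 hki.2]
      · intro p hp
        refine hk _ ?_
        rw [Equiv.swap_apply_def]
        simp only [Fin.le_def, ne_eq, Fin.ext_iff] at *
        split_ifs <;> omega

/-- If `α q` is weakly larger than all later entries, then the coefficient of `x_q ^ α q` in the
key polynomial of `α` is the key polynomial of `α` with the entry `α q` deleted. -/
theorem coeff_keyPoly_add_single (α : Fin n → ℕ) {m : ℕ} (e : Fin m → Fin n)
    (he : StrictMono e) (q : Fin n) (hq : ∀ p, p ∈ Set.range e ↔ p ≠ q)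
    (hmax : ∀ p, q ≤ p → α p ≤ α q) (d : Fin m →₀ ℕ) :
    coeff (d.mapDomain e + Finsupp.single q (α q)) (keyPoly α) = coeff d (keyPoly (α ∘ e)) := by
  induction α using ascent_induction generalizing e q d with
  | antitone α hα =>
    rw [keyPoly_of_antitone hα, keyPoly_of_antitone (hα.comp_monotone he.monotone),
      ← mapDomain_equivFunOnFinite_comp_add_single he.injective hq, coeff_monomial,
      coeff_monomial]
    simp only [add_left_inj, (Finsupp.mapDomain_injective he.injective).eq_iff]
  | ascent α i j hij hlt ih =>
    have hne := ne_of_val_add_one hij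
    have hqi : q ≠ i := by
      rintro rfl
      exact absurd (hmax j (Fin.le_def.mpr (by omega))) (by omega)
    rw [keyPoly_of_ascent hij hlt]
    have ih' := fun e he q hq hmax d => ih (α ∘ Equiv.swap i j) (wt_swap_lt α hij hlt)
      e he q hq hmax d
    -- For `q = j` the extreme power of `x_j` is turned by the swap into that of `x_i`, where the
    -- large entry sits in the swapped composition. Otherwise `q` is neither `i` nor `j`, and
    -- extracting its power commutes with `xi`.
    by_cases hqj : q = j
    · subst hqj
      have hi : ∀ p, i ≤ p → (α ∘ Equiv.swap i q) p ≤ α q := by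
        intro p hp
        rw [Function.comp_apply, Equiv.swap_apply_def]
        split_ifs with h1 h2
        · exact le_rfl
        · exact hlt.le
        · refine hmax p ?_
          simp only [Fin.le_def, Fin.ext_iff] at *
          omega
      rw [coeff_xi_of_le_right hne (a := α q)
        (fun d hd => coeff_keyPoly_eq_zero_of_lt _ hi hd)
        (fun d hd => coeff_keyPoly_eq_zero_of_lt _
          (fun p hp => hi p (le_trans (Fin.le_def.mpr (by omega)) hp)) hd),
        Finsupp.mapDomain_add, ← Finsupp.mapDomain_comp, Finsupp.mapDomain_single,
        Equiv.swap_apply_right]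
      · have := ih' (Equiv.swap i q ∘ e)
          (strictMono_swap_comp he hij (Or.inr (by simp [hq]))) i ?_ ?_ d
        · rw [Function.comp_apply, Equiv.swap_apply_left] at this
          rw [this]
          congr 2
          funext p
          simp
        · intro p
          rw [Set.range_comp, Equiv.image_eq_preimage_symm, Set.mem_preimage, hq,
            Equiv.symm_swap, not_iff_not, Equiv.swap_apply_eq_iff, Equiv.swap_apply_right]
        · intro p hp
          simpa using hi p hp
      · simp
    · obtain ⟨a, b, hab, rfl, rfl⟩ := exists_adjacent_preimage he hij
        ((hq i).mpr (Ne.symm hqi)) ((hq j).mpr (Ne.symm hqj))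
      have hcomp : (α ∘ Equiv.swap (e a) (e b)) ∘ e = (α ∘ e) ∘ Equiv.swap a b := by
        rw [Function.comp_assoc, he.injective.swap_comp, Function.comp_assoc]
      rw [keyPoly_of_ascent hab (α := α ∘ e) hlt, ← hcomp]
      have hαq : (α ∘ Equiv.swap (e a) (e b)) q = α q := by
        rw [Function.comp_apply, Equiv.swap_apply_of_ne_of_ne hqi hqj]
      refine coeff_mapDomain_add_xi he.injective (ne_of_val_add_one hab) (by simp [hqi])
        (by simp [hqj]) (fun d => ?_) d
      rw [← hαq]
      refine ih' e he q hq (fun p hp => ?_) d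
      rw [hαq]
      refine hmax _ ?_
      rw [Equiv.swap_apply_def]
      simp only [Fin.le_def, ne_eq, Fin.ext_iff] at *
      split_ifs <;> omega

theorem coeff_keyPoly_eq_zero_of_degree_ne (α : Fin n → ℕ) {d : Fin n →₀ ℕ}
    (hd : d.degree ≠ ∑ p, α p) : coeff d (keyPoly α) = 0 := by
  induction α using ascent_induction generalizing d with
  | antitone α hα =>
    rw [keyPoly_of_antitone hα, coeff_monomial, if_neg]
    rintro rfl
    exact hd (by simp [Finsupp.degree_eq_sum])
  | ascent α i j hij hlt ih =>
    rw [keyPoly_of_ascent hij hlt]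
    refine coeff_xi_eq_zero (ne_of_val_add_one hij)
      (P := fun d => d.degree ≠ ∑ p, α p) ?_ ?_ (fun d hd => ih _ (wt_swap_lt α hij hlt) ?_) hd
    · intro d
      simp
    · intro d
      rw [Finsupp.degree_mapDomain]
      exact id
    · rwa [Function.comp_def, Equiv.sum_comp (Equiv.swap i j) α]

/-- The maximality hypothesis is automatic at the last position, so the last variable can always be
peeled off; this drives the induction for triangularity. -/
theorem coeff_keyPoly_succ {α β : Fin (n + 1) → ℕ} (h : β (Fin.last n) = α (Fin.last n)) :
    coeff (Finsupp.equivFunOnFinite.symm β) (keyPoly α) =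
      coeff (Finsupp.equivFunOnFinite.symm (β ∘ Fin.castSucc)) (keyPoly (α ∘ Fin.castSucc)) := by
  have hq : ∀ p, p ∈ Set.range (Fin.castSucc (n := n)) ↔ p ≠ Fin.last n := by
    intro p
    exact Fin.exists_castSucc_eq
  rw [← coeff_keyPoly_add_single α Fin.castSucc Fin.strictMono_castSucc (Fin.last n) hq,
    ← h, mapDomain_equivFunOnFinite_comp_add_single (Fin.castSucc_injective n) hq]
  intro p hp
  rw [Fin.last_le_iff.mp hp]

theorem coeff_keyPoly_self (α : Fin n → ℕ) :
    coeff (Finsupp.equivFunOnFinite.symm α) (keyPoly α) = 1 := by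
  induction n with
  | zero =>
    rw [keyPoly_of_antitone fun p => p.elim0, coeff_monomial, if_pos rfl]
  | succ n ih => rw [coeff_keyPoly_succ rfl, ih]

/-- The exponents of a key polynomial are at most `α` in the reverse lexicographic order. -/
theorem eq_or_lt_of_coeff_keyPoly_ne_zero (α β : Fin n → ℕ)
    (h : coeff (Finsupp.equivFunOnFinite.symm β) (keyPoly α) ≠ 0) :
    β = α ∨ ∃ p, (∀ q, p < q → β q = α q) ∧ β p < α p := by
  induction n with
  | zero => exact Or.inl (Subsingleton.elim _ _)
  | succ n ih =>
    -- A smaller last exponent settles the comparison, an equal one is peeled off, and a larger one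
    -- contradicts the degree bound.
    rcases lt_trichotomy (β (Fin.last n)) (α (Fin.last n)) with hlt | heq | hgt
    · exact Or.inr ⟨_, fun q hq => absurd (Fin.le_last q) (not_le.mpr hq), hlt⟩
    · rw [coeff_keyPoly_succ heq] at h
      rcases ih _ _ h with h' | ⟨p, hp, hlt⟩
      · refine Or.inl (funext fun p => ?_)
        induction p using Fin.lastCases with
        | last => exact heq
        | cast p => exact congrFun h' p
      · refine Or.inr ⟨p.castSucc, fun q hq => ?_, hlt⟩
        induction q using Fin.lastCases with
        | last => exact heq
        | cast q => exact hp q (by simpa using hq)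
    · refine absurd (coeff_keyPoly_eq_zero_of_lt α (k := Fin.last n) (a := α (Fin.last n)) ?_
        (by simpa using hgt)) h
      intro p hp
      rw [Fin.last_le_iff.mp hp]

end KeyCoefficients

/-! ### Symmetry of key polynomials along weakly increasing stretches -/

section KeySymmetry

variable {n : ℕ}

/-- Remove an ascent `(k, l)`. If it is disjoint from `(i, j)` the operators commute. If it shares
an index, a second ascent can be removed, after which the equal entries sit at `(k, l)`; inserting
`xi k l` there by induction and applying the braid relation brings `xi i j` to the front, where it
is idempotent. -/
theorem xi_keyPoly_of_eq (α : Fin n → ℕ) {i j : Fin n} (hij : (i : ℕ) + 1 = j)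
    (h : α i = α j) : xi i j (keyPoly α) = keyPoly α := by
  induction α using ascent_induction generalizing i j with
  | antitone α hα =>
    apply xi_eq_self (ne_of_val_add_one hij)
    rw [keyPoly_of_antitone hα, rename_monomial]
    refine congrArg (fun d => monomial d 1) (Finsupp.ext fun p => ?_)
    rw [Finsupp.mapDomain_equiv_apply, Equiv.symm_swap, Equiv.swap_apply_def]
    split_ifs with h1 h2
    · simp [h1, h]
    · simp [h2, h]
    · rfl
  | ascent α k l hkl hlt ih =>
    have nij := ne_of_val_add_one hij
    have nkl := ne_of_val_add_one hkl
    have c1 : k ≠ i := by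
      rintro rfl
      obtain rfl : l = j := by ext; omega
      omega
    have njl : j ≠ l := by
      rintro rfl
      exact c1 (by ext; omega)
    have w := wt_swap_lt α hkl hlt
    by_cases c2 : l = i
    · subst c2
      have nkj : k ≠ j := by rintro rfl; omega
      have sj : Equiv.swap k l j = j := Equiv.swap_apply_of_ne_of_ne nkj.symm nij.symm
      have tk : Equiv.swap l j k = k := Equiv.swap_apply_of_ne_of_ne nkl nkj
      have h' : (α ∘ Equiv.swap k l) l < (α ∘ Equiv.swap k l) j := by simp [sj]; omega
      have w' := wt_swap_lt _ hij h'
      have e := ih _ (w'.trans w) hkl (by simp [sj, tk, h])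
      rw [keyPoly_of_ascent hkl hlt, keyPoly_of_ascent hij h', ← e,
        xi_braid nkl nij nkj, xi_xi nij]
    by_cases c3 : j = k
    · subst c3
      have nil : i ≠ l := by rintro rfl; omega
      have si : Equiv.swap j l i = i := Equiv.swap_apply_of_ne_of_ne nij nil
      have tl : Equiv.swap i j l = l := Equiv.swap_apply_of_ne_of_ne nil.symm njl.symm
      have h' : (α ∘ Equiv.swap j l) i < (α ∘ Equiv.swap j l) j := by simp [si]; omega
      have w' := wt_swap_lt _ hij h'
      have e := ih _ (w'.trans w) hkl (by simp [si, tl, h])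
      rw [keyPoly_of_ascent hkl hlt, keyPoly_of_ascent hij h', ← e,
        ← xi_braid nij nkl nil, xi_xi nij]
    have e := ih _ w hij (by
      simp only [Function.comp_apply]
      rw [Equiv.swap_apply_of_ne_of_ne (Ne.symm c1) (Ne.symm c2),
        Equiv.swap_apply_of_ne_of_ne c3 njl, h])
    rw [keyPoly_of_ascent hkl hlt, ← e,
      xi_comm nkl nij c1 (Ne.symm c3) c2 njl.symm, xi_xi nij]

theorem rename_swap_keyPoly_of_le {α : Fin n → ℕ} {i j : Fin n} (hij : (i : ℕ) + 1 = j)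
    (h : α i ≤ α j) : rename (Equiv.swap i j) (keyPoly α) = keyPoly α := by
  have nij := ne_of_val_add_one hij
  rcases h.lt_or_eq with hlt | heq
  · rw [keyPoly_of_ascent hij hlt, rename_swap_xi nij]
  · rw [← xi_keyPoly_of_eq α hij heq, rename_swap_xi nij]

/-- If the composition `α` is weakly increasing on each fibre of a monotone map `W`, then its key
polynomial is symmetric in the variables of each fibre. -/
theorem rename_perm_keyPoly {ι : Type*} [PartialOrder ι] {W : Fin n → ι} (hW : Monotone W)
    {α : Fin n → ℕ} (hα : ∀ p q, p ≤ q → W p = W q → α p ≤ α q) {π : Equiv.Perm (Fin n)}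
    (hπ : ∀ p, W (π p) = W p) : rename π (keyPoly α) = keyPoly α := by
  -- The stabilizer of the key polynomial. It contains the adjacent swaps inside a fibre, then by
  -- conjugation all swaps inside a fibre, and these generate the fibre-preserving permutations.
  let G : Subgroup (Equiv.Perm (Fin n)) :=
    { carrier := {σ | rename σ (keyPoly α) = keyPoly α}
      one_mem' := by simp
      mul_mem' := fun {σ τ} hσ hτ => by
        simp only [Set.mem_ofPred_eq] at *
        rw [Equiv.Perm.coe_mul, ← rename_rename, hτ, hσ]
      inv_mem' := fun {σ} hσ => by
        simp only [Set.mem_ofPred_eq] at *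
        conv_lhs => rw [← hσ]
        rw [rename_rename, ← Equiv.Perm.coe_mul, inv_mul_cancel]
        simp }
  have hswap : ∀ (k : ℕ) (p q : Fin n), (p : ℕ) + k = q → W p = W q → Equiv.swap p q ∈ G := by
    intro k
    induction k with
    | zero =>
      intro p q hpq _
      obtain rfl : p = q := by ext; omega
      rw [Equiv.swap_self]
      exact G.one_mem
    | succ k ih =>
      intro p q hpq hW'
      -- The neighbour to the left of `q`, in the same fibre because `W` is monotone.
      let t : Fin n := ⟨p + k, by omega⟩
      have htq : (t : ℕ) + 1 = q := by simp [t]; omega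
      have hpt : W p = W t := le_antisymm (hW (Fin.le_def.mpr (by simp [t])))
        (hW' ▸ hW (Fin.le_def.mpr (by omega)))
      have h1 : Equiv.swap t q ∈ G := rename_swap_keyPoly_of_le htq
        (hα _ _ (Fin.le_def.mpr (by omega)) (hpt ▸ hW'))
      rcases Nat.eq_zero_or_pos k with rfl | hk
      · have hpt' : p = t := by ext; simp [t]
        rwa [← hpt'] at h1
      have h2 := G.mul_mem (G.mul_mem h1 (ih p t rfl hpt)) h1
      rwa [Equiv.swap_mul_swap_mul_swap (Fin.ne_of_lt (Fin.lt_def.mpr (by simp [t]; omega)))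
        (Fin.ne_of_lt (Fin.lt_def.mpr (by omega))), Equiv.swap_comm] at h2
  have hclosure : π ∈ Subgroup.closure
      {σ : Equiv.Perm (Fin n) | ∃ p q, p ≠ q ∧ W p = W q ∧ σ = Equiv.swap p q} := by
    rw [mem_closure_isSwap]
    · refine ⟨Set.toFinite _, fun p => ⟨⟨Equiv.swap p (π p), ?_⟩, Equiv.swap_apply_left p (π p)⟩⟩
      by_cases h : p = π p
      · rw [← h, Equiv.swap_self]
        exact Subgroup.one_mem _
      · exact Subgroup.subset_closure ⟨p, π p, h, (hπ p).symm, rfl⟩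
    · rintro σ ⟨p, q, hpq, -, rfl⟩
      exact ⟨p, q, hpq, rfl⟩
  refine (Subgroup.closure_le G).mpr ?_ hclosure
  rintro σ ⟨p, q, -, hWpq, rfl⟩
  rcases le_total p q with h | h
  · exact hswap (q - p) p q (by have := Fin.le_def.mp h; omega) hWpq
  · rw [Equiv.swap_comm]
    exact hswap (p - q) q p (by have := Fin.le_def.mp h; omega) hWpq.symm

end KeySymmetry

/-! ### Types of exponents and coefficients of `m_μ` -/

section Types

/-- Pigeonhole: if `ν_k > μ_k`, then `w` injects the `k + 1` indices `0, …, k` into the `k` indices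
where `μ` can exceed `μ_k`. -/
theorem Par.parts_le_of_perm {μ ν : Par} {w : Equiv.Perm ℕ}
    (h : ∀ j, μ.parts (w j) = ν.parts j) (k : ℕ) : ν.parts k ≤ μ.parts k := by
  by_contra hlt
  have hmaps : ∀ j ∈ Finset.range (k + 1), w j ∈ Finset.range k := by
    intro j hj
    rw [Finset.mem_range] at *
    by_contra hk
    have h1 := μ.anti (not_lt.mp hk)
    have h2 := ν.anti (Nat.lt_succ_iff.mp hj)
    have h3 := h j
    omega
  have := Finset.card_le_card_of_injOn w hmaps w.injective.injOn
  simp at this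

theorem Par.eq_of_perm {μ ν : Par} {w : Equiv.Perm ℕ}
    (h : ∀ j, μ.parts (w j) = ν.parts j) : μ = ν := by
  ext k
  refine le_antisymm (Par.parts_le_of_perm (w := w.symm) (fun j => ?_) k)
    (Par.parts_le_of_perm h k)
  rw [← h, Equiv.apply_symm_apply]

theorem exists_sorting_perm {g : ℕ → ℕ} {N : ℕ} (hg : ∀ j, N ≤ j → g j = 0) :
    ∃ (μ : Par) (w : Equiv.Perm ℕ), (∀ j, N ≤ j → w j = j) ∧ ∀ j, g (w j) = μ.parts j := by
  -- The order dual makes `Tuple.sort` sort decreasingly. Sorting only below `N` keeps the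
  -- permutation inside every window of size at least `N`.
  let f : Fin N → ℕᵒᵈ := fun j => OrderDual.toDual (g j)
  let w : Equiv.Perm ℕ := (Tuple.sort f).extendDomain Fin.equivSubtype
  have hw : ∀ j, N ≤ j → w j = j := fun j hj =>
    Equiv.Perm.extendDomain_apply_not_subtype _ _ (not_lt.mpr hj)
  have hw' : ∀ j (hj : j < N), w j = Tuple.sort f ⟨j, hj⟩ := fun j hj => by
    exact Equiv.Perm.extendDomain_apply_subtype (Tuple.sort f) Fin.equivSubtype hj
  have hz : ∀ j, N ≤ j → g (w j) = 0 := fun j hj => by rw [hw j hj, hg j hj]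
  refine ⟨⟨Finsupp.onFinset (Finset.range N) (fun j => g (w j)) fun j hj => ?_, ?_⟩, w, hw,
    fun j => rfl⟩
  · rw [Finset.mem_range]
    by_contra hN
    exact hj (hz j (not_lt.mp hN))
  · intro a b hab
    simp only [Finsupp.onFinset_apply]
    rcases le_or_gt N b with hb | hb
    · rw [hz b hb]; exact Nat.zero_le _
    · rw [hw' a (by omega), hw' b hb]
      exact Tuple.monotone_sort f (show (⟨a, by omega⟩ : Fin N) ≤ ⟨b, hb⟩ from hab)

variable {r : ℕ}

/-- The exponent `d` has type `μ` if, for each `i`, the exponents of the variables in the `i`-th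
set form a rearrangement of `μ i`. -/
def HasType (d : Fin r × ℕ →₀ ℕ) (μ : Fin r → Par) : Prop :=
  ∀ i, ∃ w : Equiv.Perm ℕ, ∀ j, d (i, w j) = (μ i).parts j

theorem HasType.unique {d : Fin r × ℕ →₀ ℕ} {μ ν : Fin r → Par} (hμ : HasType d μ)
    (hν : HasType d ν) : μ = ν := by
  funext i
  obtain ⟨w, hw⟩ := hμ i
  obtain ⟨v, hv⟩ := hν i
  refine Par.eq_of_perm (w := v.trans w.symm) fun j => ?_
  rw [← hw, ← hv, Equiv.trans_apply, Equiv.apply_symm_apply]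

theorem exists_hasType (μ : Fin r → Par) : ∃ d : Fin r × ℕ →₀ ℕ, HasType d μ := by
  refine ⟨∑ i, (μ i).parts.mapDomain (Prod.mk i), fun i => ⟨1, fun j => ?_⟩⟩
  rw [Equiv.Perm.one_apply, Finsupp.finsetSum_apply, Finset.sum_eq_single i]
  · rw [Finsupp.mapDomain_apply (Prod.mk_right_injective i)]
  · intro k _ hk
    rw [Finsupp.mapDomain_of_notMem_range]
    rintro ⟨a, ha⟩
    exact hk (congrArg Prod.fst ha)
  · simp

theorem eq_mapDomain_mk_iff (d : Fin r × ℕ →₀ ℕ) (i : Fin r) (lam : Par)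
    (w : Equiv.Perm ℕ) : d = lam.parts.mapDomain (fun j => (i, w j)) ↔
      (∀ j, d (i, w j) = lam.parts j) ∧ ∀ k j, k ≠ i → d (k, j) = 0 := by
  have hinj : Function.Injective fun j => (i, w j) := fun a b h => by simpa using h
  have hout : ∀ k j, k ≠ i → (k, j) ∉ Set.range fun j => (i, w j) := by
    rintro k j hk ⟨a, ha⟩
    exact hk (congrArg Prod.fst ha).symm
  constructor
  · rintro rfl
    exact ⟨fun j => Finsupp.mapDomain_apply hinj _ _,
      fun k j hk => Finsupp.mapDomain_of_notMem_range _ _ (hout k j hk)⟩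
  · rintro ⟨h1, h2⟩
    ext ⟨k, j⟩
    by_cases hk : k = i
    · subst hk
      have h3 := h1 (w.symm j)
      have h4 := Finsupp.mapDomain_apply hinj lam.parts (w.symm j)
      simp only [Equiv.apply_symm_apply] at h3 h4
      rw [h3, h4]
    · rw [h2 k j hk, Finsupp.mapDomain_of_notMem_range _ _ (hout k j hk)]

open Classical in
theorem coeff_monomialSym (i : Fin r) (lam : Par) (d : Fin r × ℕ →₀ ℕ) :
    MvPowerSeries.coeff d (monomialSym i lam) =
      if (∃ w : Equiv.Perm ℕ, ∀ j, d (i, w j) = lam.parts j) ∧ ∀ k j, k ≠ i → d (k, j) = 0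
      then 1 else 0 := by
  refine if_congr ?_ rfl rfl
  simp only [eq_mapDomain_mk_iff, exists_and_right]

open Classical in
theorem coeff_multiMonomial (μ : Fin r → Par) (d : Fin r × ℕ →₀ ℕ) :
    MvPowerSeries.coeff d (multiMonomial μ) = if HasType d μ then 1 else 0 := by
  -- The only decomposition of `d` that can contribute to the product: its restrictions to the `r`
  -- sets of variables.
  let l₀ : Fin r →₀ (Fin r × ℕ →₀ ℕ) :=
    Finsupp.equivFunOnFinite.symm fun i => d.filter fun p => p.1 = i
  have hl₀ : ∀ i k j, l₀ i (k, j) = if k = i then d (k, j) else 0 := fun i k j => by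
    simp [l₀, Finsupp.filter_apply]
  rw [multiMonomial, MvPowerSeries.coeff_prod, Finset.sum_eq_single l₀]
  · simp only [coeff_monomialSym]
    split_ifs with h
    · refine Finset.prod_eq_one fun i _ => if_pos ⟨?_, fun k j hk => by rw [hl₀, if_neg hk]⟩
      obtain ⟨w, hw⟩ := h i
      exact ⟨w, fun j => by rw [← hw, hl₀, if_pos rfl]⟩
    · rw [HasType, not_forall] at h
      obtain ⟨i, hi⟩ := h
      refine Finset.prod_eq_zero (Finset.mem_univ i) (if_neg ?_)
      rintro ⟨⟨w, hw⟩, -⟩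
      exact hi ⟨w, fun j => by rw [← hw, hl₀, if_pos rfl]⟩
  · intro l hl hne
    rw [Finset.mem_finsuppAntidiag] at hl
    by_contra hprod
    rw [← ne_eq, Finset.prod_ne_zero_iff] at hprod
    have hsupp : ∀ i k j, k ≠ i → l i (k, j) = 0 := by
      intro i
      have := hprod i (Finset.mem_univ i)
      rw [coeff_monomialSym] at this
      exact (of_not_not fun hn => this (if_neg hn) : _ ∧ _).2
    apply hne
    ext i ⟨k, j⟩
    rw [hl₀]
    split_ifs with hk
    · subst hk
      rw [← hl.1, Finsupp.finsetSum_apply, Finset.sum_eq_single k]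
      · intro i _ hi
        exact hsupp i k j hi.symm
      · simp
    · exact hsupp i k j hk
  · intro h
    refine absurd ?_ h
    rw [Finset.mem_finsuppAntidiag]
    refine ⟨?_, Finset.subset_univ _⟩
    ext ⟨k, j⟩
    simp [Finsupp.finsetSum_apply, hl₀]

end Types

/-! ### Window compositions, stable coefficients and finiteness -/

section Windows

variable {r : ℕ}

theorem finSigmaFinEquiv_lt_of_fst_lt {n : Fin r → ℕ} {s t : (i : Fin r) × Fin (n i)}
    (h : s.1 < t.1) : finSigmaFinEquiv s < finSigmaFinEquiv t := by
  rw [Fin.lt_def, finSigmaFinEquiv_apply, finSigmaFinEquiv_apply]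
  -- Extension by zero, so that both offsets become sums over initial ranges of `ℕ`.
  let N : ℕ → ℕ := fun k => if hk : k < r then n ⟨k, hk⟩ else 0
  have hN : ∀ i : Fin r, ∑ k : Fin i, n (Fin.castLE i.2.le k) = ∑ k ∈ Finset.range i, N k := by
    intro i
    rw [← Fin.sum_univ_eq_sum_range]
    refine Finset.sum_congr rfl fun k _ => ?_
    simp only [N]
    rw [dif_pos (k.2.trans i.2)]
    rfl
  rw [hN, hN]
  have h1 : ∑ k ∈ Finset.range (s.1 + 1), N k ≤ ∑ k ∈ Finset.range t.1, N k :=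
    Finset.sum_le_sum_of_subset (Finset.range_mono h)
  rw [Finset.sum_range_succ] at h1
  have h2 : N s.1 = n s.1 := by simp [N]
  have h3 := s.2.2
  omega

theorem finSigmaFinEquiv_mk_lt_iff {n : Fin r → ℕ} {i : Fin r} {a b : Fin (n i)} :
    finSigmaFinEquiv (n := n) ⟨i, a⟩ < finSigmaFinEquiv ⟨i, b⟩ ↔ a < b := by
  rw [Fin.lt_def, finSigmaFinEquiv_apply, finSigmaFinEquiv_apply, Fin.lt_def]
  simp

theorem monotone_window (n : Fin r → ℕ) :
    Monotone fun p : Fin (∑ i, n i) => (finSigmaFinEquiv.symm p).1 := by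
  intro p q hpq
  by_contra h
  have := finSigmaFinEquiv_lt_of_fst_lt (not_le.mp h)
  simp only [Equiv.apply_symm_apply] at this
  exact absurd hpq (not_le.mpr this)

theorem windowComp_apply (μ : Fin r → Par) (n : Fin r → ℕ) (i : Fin r) (a : Fin (n i)) :
    windowComp μ n (finSigmaFinEquiv ⟨i, a⟩) = (μ i).parts (Fin.rev a) := by
  rw [windowComp, Equiv.symm_apply_apply]

theorem forall_window {n : Fin r → ℕ} {P : Fin (∑ i, n i) → Prop} :
    (∀ p, P p) ↔ ∀ i (a : Fin (n i)), P (finSigmaFinEquiv ⟨i, a⟩) := by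
  rw [← finSigmaFinEquiv.forall_congr_right (q := P), Sigma.forall]

theorem windowComp_le_of_le (μ : Fin r → Par) (n : Fin r → ℕ) (p q : Fin (∑ i, n i))
    (hpq : p ≤ q) (h : (finSigmaFinEquiv.symm p).1 = (finSigmaFinEquiv.symm q).1) :
    windowComp μ n p ≤ windowComp μ n q := by
  obtain ⟨⟨i, a⟩, rfl⟩ := finSigmaFinEquiv.surjective p
  obtain ⟨⟨k, b⟩, rfl⟩ := finSigmaFinEquiv.surjective q
  simp only [Equiv.symm_apply_apply] at h
  subst h
  rw [windowComp_apply, windowComp_apply]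
  apply (μ i).anti
  have hab : a ≤ b := by
    rw [← not_lt, finSigmaFinEquiv_mk_lt_iff (n := n), not_lt] at *
    exact hpq
  exact Fin.rev_le_rev.mpr hab

/-- All windows `n i` have room for the partition `μ i`. -/
def Fits (μ : Fin r → Par) (n : Fin r → ℕ) : Prop :=
  ∀ i j, n i ≤ j → (μ i).parts j = 0

theorem Fits.mono {μ : Fin r → Par} {n n' : Fin r → ℕ} (h : Fits μ n) (hn : n ≤ n') :
    Fits μ n' :=
  fun i j hj => h i j ((hn i).trans hj)

/-- The number of parts of a partition. -/
noncomputable def Par.length (μ : Par) : ℕ := μ.parts.support.sup Nat.succ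

theorem fits_length (μ : Fin r → Par) : Fits μ fun i => (μ i).length := by
  intro i j hj
  by_contra h
  have := Finset.le_sup (f := Nat.succ) (Finsupp.mem_support_iff.mpr h)
  exact absurd hj (not_le.mpr this)

/-- The coefficient of the monomial with exponent `windowComp μ n` in `𝒮_λ^{(n_1|…|n_r)}`. -/
noncomputable def windowCoeff (lam μ : Fin r → Par) (n : Fin r → ℕ) : ℚ :=
  coeff (Finsupp.equivFunOnFinite.symm (windowComp μ n)) (keyPoly (windowComp lam n))

/-- The embedding of smaller windows at the right ends of larger ones. -/
def windowShift {n n' : Fin r → ℕ} (hn : n ≤ n') (s : (i : Fin r) × Fin (n i)) :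
    (i : Fin r) × Fin (n' i) :=
  ⟨s.1, ⟨s.2 + (n' s.1 - n s.1), by
    have h1 := s.2.2
    have h2 : n s.1 ≤ n' s.1 := hn s.1
    omega⟩⟩

/-- The embedding of smaller windows at the right ends of larger ones, on positions. -/
def windowEmb {n n' : Fin r → ℕ} (hn : n ≤ n') (p : Fin (∑ i, n i)) : Fin (∑ i, n' i) :=
  finSigmaFinEquiv (windowShift hn (finSigmaFinEquiv.symm p))

theorem windowEmb_apply {n n' : Fin r → ℕ} (hn : n ≤ n') (s : (i : Fin r) × Fin (n i)) :
    windowEmb hn (finSigmaFinEquiv s) = finSigmaFinEquiv (windowShift hn s) := by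
  rw [windowEmb, Equiv.symm_apply_apply]

theorem strictMono_windowEmb {n n' : Fin r → ℕ} (hn : n ≤ n') : StrictMono (windowEmb hn) := by
  intro p q hpq
  obtain ⟨⟨i, a⟩, rfl⟩ := finSigmaFinEquiv.surjective p
  obtain ⟨⟨k, b⟩, rfl⟩ := finSigmaFinEquiv.surjective q
  have hik : i ≤ k := by simpa using monotone_window n hpq.le
  rw [windowEmb_apply, windowEmb_apply]
  rcases hik.lt_or_eq with h | rfl
  · exact finSigmaFinEquiv_lt_of_fst_lt h
  · rw [finSigmaFinEquiv_mk_lt_iff (n := n), Fin.lt_def] at hpq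
    refine finSigmaFinEquiv_mk_lt_iff.mpr ?_
    rw [Fin.lt_def]
    simpa using hpq

theorem windowComp_comp_windowEmb (μ : Fin r → Par) {n n' : Fin r → ℕ} (hn : n ≤ n') :
    windowComp μ n' ∘ windowEmb hn = windowComp μ n := by
  refine funext (forall_window.mpr fun i a => ?_)
  rw [Function.comp_apply, windowEmb_apply, windowShift, windowComp_apply, windowComp_apply]
  simp only [Fin.val_rev]
  congr 1
  have : n i ≤ n' i := hn i
  omega

theorem windowComp_eq_zero {μ : Fin r → Par} {n n' : Fin r → ℕ} (hμ : Fits μ n) (hn : n ≤ n')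
    (p : Fin (∑ i, n' i)) (hp : p ∉ Set.range (windowEmb hn)) : windowComp μ n' p = 0 := by
  obtain ⟨⟨i, a⟩, rfl⟩ := finSigmaFinEquiv.surjective p
  rw [windowComp_apply]
  apply hμ
  by_contra h
  apply hp
  rw [Fin.val_rev] at h
  have h1 : n i ≤ n' i := hn i
  have h2 := a.2
  refine ⟨finSigmaFinEquiv ⟨i, ⟨a - (n' i - n i), by omega⟩⟩, ?_⟩
  rw [windowEmb_apply, windowShift]
  congr 2
  ext
  simp only
  omega

/-- Larger windows only add zeros at the left end of each window, in both compositions, so stability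
of key polynomials applies. -/
theorem windowCoeff_of_le {lam μ : Fin r → Par} {n n' : Fin r → ℕ} (hlam : Fits lam n)
    (hμ : Fits μ n) (hn : n ≤ n') : windowCoeff lam μ n' = windowCoeff lam μ n := by
  have he := strictMono_windowEmb hn
  rw [windowCoeff, windowCoeff, ← mapDomain_equivFunOnFinite_comp he.injective
    (windowComp_eq_zero hμ hn), coeff_keyPoly_mapDomain _ _ he (windowComp_eq_zero hlam hn),
    windowComp_comp_windowEmb, windowComp_comp_windowEmb]

theorem sum_windowComp {μ : Fin r → Par} {n : Fin r → ℕ} (h : Fits μ n) :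
    ∑ p, windowComp μ n p = ∑ i, (μ i).parts.degree := by
  rw [← finSigmaFinEquiv.sum_comp, Fintype.sum_sigma]
  refine Finset.sum_congr rfl fun i _ => ?_
  simp only [windowComp_apply]
  rw [← Equiv.sum_comp Fin.revPerm]
  simp only [Fin.revPerm_apply, Fin.rev_rev]
  rw [Fin.sum_univ_eq_sum_range (fun j => (μ i).parts j), Finsupp.degree_apply]
  refine (Finset.sum_subset (fun j hj => ?_) fun j _ hj => Finsupp.notMem_support_iff.mp hj).symm
  rw [Finset.mem_range]
  by_contra hn
  exact Finsupp.mem_support_iff.mp hj (h i j (not_lt.mp hn))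

theorem parts_eq_windowComp (μ : Fin r → Par) {n : Fin r → ℕ} {i : Fin r} {j : ℕ}
    (hj : j < n i) :
    (μ i).parts j = windowComp μ n (finSigmaFinEquiv ⟨i, Fin.rev ⟨j, hj⟩⟩) := by
  rw [windowComp_apply, Fin.rev_rev]

/-- Reading a window composition from the right meets the last partition first and, within it, the
largest part first; so the last difference of the compositions is what `≺` inspects. -/
theorem eq_or_prec_of_windowCoeff_ne_zero {lam μ : Fin r → Par} {n : Fin r → ℕ}
    (hlam : Fits lam n) (hμ : Fits μ n) (h : windowCoeff lam μ n ≠ 0) :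
    μ = lam ∨ Prec μ lam := by
  have hext : ∀ i, (∀ a, windowComp μ n (finSigmaFinEquiv ⟨i, a⟩) =
      windowComp lam n (finSigmaFinEquiv ⟨i, a⟩)) → μ i = lam i := by
    intro i hi
    ext j
    rcases lt_or_ge j (n i) with hj | hj
    · rw [parts_eq_windowComp μ hj, parts_eq_windowComp lam hj, hi]
    · rw [hlam i j hj, hμ i j hj]
  rcases eq_or_lt_of_coeff_keyPoly_ne_zero _ _ h with heq | ⟨p, hp, hlt⟩
  · exact Or.inl (funext fun i => hext i fun a => congrFun heq _)
  · obtain ⟨⟨k, a⟩, rfl⟩ := finSigmaFinEquiv.surjective p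
    refine Or.inr ⟨k, fun i hi => hext i fun a => hp _ (finSigmaFinEquiv_lt_of_fst_lt hi),
      Fin.rev a, fun j hj => ?_, ?_⟩
    · have hj' : j < n k := hj.trans (Fin.rev a).2
      rw [parts_eq_windowComp μ hj', parts_eq_windowComp lam hj']
      refine hp _ (finSigmaFinEquiv_mk_lt_iff.mpr ?_)
      rw [Fin.lt_rev_iff]
      exact hj
    · rwa [windowComp_apply, windowComp_apply] at hlt

theorem coeff_multiSchurPoly (lam : Fin r → Par) {μ : Fin r → Par} {d : Fin r × ℕ →₀ ℕ} {N : ℕ}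
    {w : Fin r → Equiv.Perm ℕ} (hw : ∀ i j, N ≤ j → w i j = j)
    (hd : ∀ i j, d (i, w i j) = (μ i).parts j) (hz : ∀ i j, N ≤ j → d (i, j) = 0)
    {n : Fin r → ℕ} (hn : ∀ i, N ≤ n i) :
    coeff d (multiSchurPoly lam n) = windowCoeff lam μ n := by
  have hlt : ∀ i j, j < n i → w i j < n i := by
    intro i j hj
    by_contra h
    have h1 := (w i).injective (hw i (w i j) ((hn i).trans (not_lt.mp h)))
    omega
  let φ : Fin (∑ i, n i) → Fin r × ℕ :=
    fun p => ((finSigmaFinEquiv.symm p).1, ((finSigmaFinEquiv.symm p).2 : ℕ))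
  have hφ : ∀ i a, φ (finSigmaFinEquiv ⟨i, a⟩) = (i, (a : ℕ)) := fun i a =>
    congrArg (fun s : (i : Fin r) × Fin (n i) => (s.1, (s.2 : ℕ)))
      (finSigmaFinEquiv.symm_apply_apply ⟨i, a⟩)
  have hφinj : Function.Injective φ := by
    intro p q hpq
    obtain ⟨⟨i, a⟩, rfl⟩ := finSigmaFinEquiv.surjective p
    obtain ⟨⟨k, b⟩, rfl⟩ := finSigmaFinEquiv.surjective q
    rw [hφ, hφ, Prod.mk.injEq] at hpq
    obtain ⟨rfl, hab⟩ := hpq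
    rw [Fin.ext hab]
  -- The sorting permutations acting inside the windows; `Fin.rev` accounts for the reversed storage
  -- of the parts.
  let u : ((i : Fin r) × Fin (n i)) → (i : Fin r) × Fin (n i) :=
    fun s => ⟨s.1, ⟨w s.1 (Fin.rev s.2), hlt _ _ (Fin.rev s.2).2⟩⟩
  have hu : Function.Injective u := by
    rintro ⟨i, a⟩ ⟨k, b⟩ h
    obtain rfl : i = k := congrArg Sigma.fst h
    have h1 := congrArg Fin.val (eq_of_heq (Sigma.mk.inj h).2)
    have h2 : a = b := Fin.rev_injective (Fin.ext ((w i).injective h1))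
    rw [h2]
  let v : Equiv.Perm ((i : Fin r) × Fin (n i)) :=
    Equiv.ofBijective u (Finite.injective_iff_bijective.mp hu)
  let π : Equiv.Perm (Fin (∑ i, n i)) := finSigmaFinEquiv.permCongr v
  have hπ : ∀ i a, π (finSigmaFinEquiv ⟨i, a⟩) =
      finSigmaFinEquiv ⟨i, ⟨w i (Fin.rev a), hlt _ _ (Fin.rev a).2⟩⟩ := fun i a => by
    simp only [π, Equiv.permCongr_apply, Equiv.symm_apply_apply]
    rfl
  have hdmap : d = ((Finsupp.equivFunOnFinite.symm (windowComp μ n)).mapDomain π).mapDomain φ := by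
    ext ⟨i, j⟩
    rcases lt_or_ge j (n i) with hj | hj
    · obtain ⟨p, hp⟩ := π.surjective (finSigmaFinEquiv ⟨i, ⟨j, hj⟩⟩)
      have hij : φ (π p) = (i, j) := by rw [hp, hφ]
      rw [← hij, Finsupp.mapDomain_apply hφinj, Finsupp.mapDomain_apply π.injective]
      obtain ⟨⟨k, b⟩, rfl⟩ := finSigmaFinEquiv.surjective p
      rw [hπ, hφ, hd, Finsupp.equivFunOnFinite_symm_apply_apply, windowComp_apply]
    · rw [hz i j ((hn i).trans hj), Finsupp.mapDomain_of_notMem_range]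
      rintro ⟨p, hp⟩
      obtain ⟨⟨k, b⟩, rfl⟩ := finSigmaFinEquiv.surjective p
      rw [hφ, Prod.mk.injEq] at hp
      obtain ⟨rfl, rfl⟩ := hp
      exact absurd b.2 (not_lt.mpr hj)
  have hsym : rename π (keyPoly (windowComp lam n)) = keyPoly (windowComp lam n) := by
    refine rename_perm_keyPoly (monotone_window n) (windowComp_le_of_le lam n)
      (forall_window.mpr fun i a => ?_)
    rw [hπ]
    simp only [Equiv.symm_apply_apply]
  rw [hdmap, multiSchurPoly, coeff_rename_mapDomain φ hφinj, ← hsym,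
    coeff_rename_mapDomain _ π.injective, windowCoeff]

theorem exists_sorted (d : Fin r × ℕ →₀ ℕ) : ∃ (μ : Fin r → Par) (N : ℕ)
    (w : Fin r → Equiv.Perm ℕ), (∀ i j, N ≤ j → w i j = j) ∧
      (∀ i j, d (i, w i j) = (μ i).parts j) ∧ ∀ i j, N ≤ j → d (i, j) = 0 := by
  let N := d.support.sup fun p => p.2 + 1
  have hz : ∀ i j, N ≤ j → d (i, j) = 0 := by
    intro i j hj
    by_contra h
    have := Finset.le_sup (f := fun p : Fin r × ℕ => p.2 + 1) (Finsupp.mem_support_iff.mpr h)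
    exact absurd hj (not_le.mpr this)
  choose μ w hw hd using fun i => exists_sorting_perm (g := fun j => d (i, j)) (hz i)
  exact ⟨μ, N, w, hw, hd, hz⟩

/-- The stable value of `windowCoeff lam μ n` for large windows `n`. -/
noncomputable def stableCoeff (lam μ : Fin r → Par) : ℚ :=
  windowCoeff lam μ ((fun i => (lam i).length) ⊔ fun i => (μ i).length)

theorem windowCoeff_eq_stableCoeff {lam μ : Fin r → Par} {n : Fin r → ℕ} (hlam : Fits lam n)
    (hμ : Fits μ n) : windowCoeff lam μ n = stableCoeff lam μ := by
  -- Both window sizes are compared with their join.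
  rw [stableCoeff, ← windowCoeff_of_le hlam hμ le_sup_left, windowCoeff_of_le
    ((fits_length lam).mono le_sup_left) ((fits_length μ).mono le_sup_right) le_sup_right]

theorem stableCoeff_self (lam : Fin r → Par) : stableCoeff lam lam = 1 :=
  coeff_keyPoly_self _

theorem eq_or_prec_of_stableCoeff_ne_zero {lam μ : Fin r → Par} (h : stableCoeff lam μ ≠ 0) :
    μ = lam ∨ Prec μ lam :=
  eq_or_prec_of_windowCoeff_ne_zero ((fits_length lam).mono le_sup_left)
    ((fits_length μ).mono le_sup_right) h

theorem sum_degree_eq_of_stableCoeff_ne_zero {lam μ : Fin r → Par} (h : stableCoeff lam μ ≠ 0) :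
    ∑ i, (μ i).parts.degree = ∑ i, (lam i).parts.degree := by
  rw [← sum_windowComp ((fits_length lam).mono le_sup_left),
    ← sum_windowComp ((fits_length μ).mono le_sup_right)]
  by_contra hne
  refine h (coeff_keyPoly_eq_zero_of_degree_ne _ ?_)
  simpa [Finsupp.degree_eq_sum] using hne

theorem Par.parts_eq_zero_of_degree_le (μ : Par) {M : ℕ} (h : μ.parts.degree ≤ M) {j : ℕ}
    (hj : M ≤ j) : μ.parts j = 0 := by
  by_contra hne
  have hpos : ∀ k ∈ Finset.range (j + 1), 1 ≤ μ.parts k := by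
    intro k hk
    have := μ.anti (Nat.lt_succ_iff.mp (Finset.mem_range.mp hk))
    omega
  have h1 := Finset.card_nsmul_le_sum _ _ _ hpos
  have h2 : ∑ k ∈ Finset.range (j + 1), μ.parts k ≤ μ.parts.degree := by
    rw [Finsupp.degree_apply]
    exact Finset.sum_le_sum_of_ne_zero fun k _ hk => Finsupp.mem_support_iff.mpr hk
  have h3 := h1.trans h2
  rw [Finset.card_range, smul_eq_mul, mul_one] at h3
  omega

theorem finite_support_stableCoeff (lam : Fin r → Par) :
    (Function.support (stableCoeff lam)).Finite := by
  let M := ∑ i, (lam i).parts.degree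
  -- By homogeneity every contributing partition has at most `M` parts, each at most `M`; the
  -- finitely supported functions below `g` are finite in number.
  let g : ℕ →₀ ℕ := Finsupp.indicator (Finset.range M) fun _ _ => M
  have hinj : Function.Injective fun (μ : Fin r → Par) i => (μ i).parts :=
    fun μ ν h => funext fun i => Par.ext (congrFun h i)
  refine (Set.Finite.preimage hinj.injOn
    (Set.Finite.pi' fun _ : Fin r => Set.finite_Iic g)).subset fun μ hμ i => ?_
  have hdeg : (μ i).parts.degree ≤ M := by
    refine le_of_le_of_eq ?_ (sum_degree_eq_of_stableCoeff_ne_zero hμ)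
    exact Finset.single_le_sum (f := fun i => (μ i).parts.degree) (fun _ _ => Nat.zero_le _)
      (Finset.mem_univ i)
  intro j
  rcases lt_or_ge j M with hj | hj
  · simp only [g, Finsupp.indicator_apply, Finset.mem_range, hj, dite_true]
    exact (Finsupp.le_degree j (μ i).parts).trans hdeg
  · rw [(μ i).parts_eq_zero_of_degree_le hdeg hj]
    exact Nat.zero_le _

end Windows

/-! ### Existence and uniqueness of the limit and of the expansion -/

section MonomialExpansion

variable {r : ℕ}

/-- An exponent has only one type, so it isolates a single coefficient. This yields uniqueness of
expansions and identifies the limit. -/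
theorem coeff_sum_multiMonomial {c : (Fin r → Par) →₀ ℚ} {d : Fin r × ℕ →₀ ℕ}
    {μ : Fin r → Par} (h : HasType d μ) :
    MvPowerSeries.coeff d (∑ ν ∈ c.support, c ν • multiMonomial ν) = c μ := by
  classical
  rw [map_sum]
  simp only [map_smul, smul_eq_mul, coeff_multiMonomial]
  rw [Finset.sum_eq_single μ]
  · rw [if_pos h, mul_one]
  · intro ν _ hne
    rw [if_neg fun hν => hne (hν.unique h), mul_zero]
  · intro hμ
    rw [Finsupp.notMem_support_iff.mp hμ, zero_mul]

theorem IsMonomialExpansion.unique {f : MvPowerSeries (Fin r × ℕ) ℚ}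
    {c c' : (Fin r → Par) →₀ ℚ} (h : IsMonomialExpansion f c) (h' : IsMonomialExpansion f c') :
    c = c' := by
  ext μ
  obtain ⟨d, hd⟩ := exists_hasType μ
  rw [← coeff_sum_multiMonomial (c := c) hd, ← coeff_sum_multiMonomial (c := c') hd,
    ← h, ← h']

theorem IsFormalLimit.unique {σ : Type*} {F : (Fin r → ℕ) → MvPolynomial σ ℚ}
    {f g : MvPowerSeries σ ℚ} (hf : IsFormalLimit F f) (hg : IsFormalLimit F g) : f = g := by
  ext d
  obtain ⟨n, h1, h2⟩ := ((hf d).and (hg d)).exists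
  rw [← h1, ← h2]

/-- The stable coefficients, as a finitely supported function. -/
noncomputable def stableFinsupp (lam : Fin r → Par) : (Fin r → Par) →₀ ℚ :=
  Finsupp.ofSupportFinite (stableCoeff lam) (finite_support_stableCoeff lam)

theorem isFormalLimit_stable (lam : Fin r → Par) :
    IsFormalLimit (multiSchurPoly lam)
      (∑ μ ∈ (stableFinsupp lam).support, stableFinsupp lam μ • multiMonomial μ) := by
  intro d
  obtain ⟨μ, N, w, hw, hd, hz⟩ := exists_sorted d
  rw [coeff_sum_multiMonomial (μ := μ) fun i => ⟨w i, hd i⟩]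
  -- Windows large enough for the variables in `d` and for both `λ` and `μ`.
  filter_upwards [eventually_ge_atTop fun i => max N (max (lam i).length (μ i).length)] with n hn
  rw [coeff_multiSchurPoly lam hw hd hz fun i => (le_max_left _ _).trans (hn i)]
  exact windowCoeff_eq_stableCoeff
    ((fits_length lam).mono fun i => (max_le_iff.mp (max_le_iff.mp (hn i)).2).1)
    ((fits_length μ).mono fun i => (max_le_iff.mp (max_le_iff.mp (hn i)).2).2)

theorem isFormalLimit_multiSchur (lam : Fin r → Par) :
    IsFormalLimit (multiSchurPoly lam) (multiSchur lam) := by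
  have h : ∃ f, IsFormalLimit (multiSchurPoly lam) f := ⟨_, isFormalLimit_stable lam⟩
  rw [multiSchur, dif_pos h]
  exact h.choose_spec

theorem isMonomialExpansion_stable (lam : Fin r → Par) :
    IsMonomialExpansion (multiSchur lam) (stableFinsupp lam) :=
  (isFormalLimit_multiSchur lam).unique (isFormalLimit_stable lam)

theorem isMonomialExpansion_kostka (lam : Fin r → Par) :
    IsMonomialExpansion (multiSchur lam) (kostka lam) := by
  have h : ∃ c, IsMonomialExpansion (multiSchur lam) c := ⟨_, isMonomialExpansion_stable lam⟩
  rw [kostka, dif_pos h]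
  exact h.choose_spec

theorem kostka_eq_stableCoeff (lam μ : Fin r → Par) : kostka lam μ = stableCoeff lam μ :=
  DFunLike.congr_fun ((isMonomialExpansion_kostka lam).unique (isMonomialExpansion_stable lam)) μ

theorem not_prec_self (lam : Fin r → Par) : ¬ Prec lam lam :=
  fun ⟨_, _, _, _, h⟩ => lt_irrefl _ h

end MonomialExpansion

end MultiSchur

open Classical MultiSchur in
theorem mainTheorem7 (r : ℕ) (lam : Fin r → Par) :
    -- `𝒮_λ` is the (unique) limit of the multi-symmetric Schur polynomials
    (∀ f, IsFormalLimit (multiSchurPoly lam) f ↔ f = multiSchur lam) ∧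
    -- the `K^λ_μ` are the (unique) coefficients of the monomial expansion of `𝒮_λ`
    (∀ c, IsMonomialExpansion (multiSchur lam) c ↔ c = kostka lam) ∧
    -- triangularity
    multiSchur lam = multiMonomial lam +
      ∑ μ ∈ (kostka lam).support with Prec μ lam, kostka lam μ • multiMonomial μ := by
  refine ⟨fun f => ⟨fun h => h.unique (isFormalLimit_multiSchur lam), ?_⟩,
    fun c => ⟨fun h => h.unique (isMonomialExpansion_kostka lam), ?_⟩, ?_⟩
  · rintro rfl
    exact isFormalLimit_multiSchur lam
  · rintro rfl
    exact isMonomialExpansion_kostka lam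
  · have hself : kostka lam lam = 1 := by rw [kostka_eq_stableCoeff, stableCoeff_self]
    have hmem : lam ∈ (kostka lam).support := by
      rw [Finsupp.mem_support_iff, hself]
      exact one_ne_zero
    -- Triangularity of the stable coefficients: apart from `λ` itself, the support lies below `λ`,
    -- and `≺` is irreflexive.
    have hfilter : (kostka lam).support.filter (fun μ => Prec μ lam) =
        (kostka lam).support.erase lam := by
      ext μ
      rw [Finset.mem_filter, Finset.mem_erase, and_comm]
      refine and_congr_left fun hμ => ⟨?_, fun hne => ?_⟩
      · rintro h rfl
        exact not_prec_self _ h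
      · rw [Finsupp.mem_support_iff, kostka_eq_stableCoeff] at hμ
        exact (eq_or_prec_of_stableCoeff_ne_zero hμ).resolve_left hne
    rw [hfilter]
    have h := isMonomialExpansion_kostka lam
    rwa [IsMonomialExpansion, ← Finset.add_sum_erase _ _ hmem, hself, one_smul] at h
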